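/- Let $G$ be a finite simple graph with edge set $E(G)$, and let $Q_G(x)=\sum_T\prod_{e\in T}x_e$, a polynomial in one variable $x_e$ per edge $e\in E(G)$, where $T$ ranges over all spanning trees of $G$ (identified with their edge sets). For a prime power $q$, let $g_G(q)$ be the number of ways of substituting elements of the finite field $\mathbb{F}_q$ for the variables $x_e$ so that $Q_G(x)\neq 0$ in $\mathbb{F}_q$. For integers $0\le s<n$, let $K_n-K_{1,s}$ denote the complete graph on $n$ vertices with $s$ edges incident to a common vertex removed. **Theorem.** Let $q$ be a prime power, $m\ge 1$ and $s\ge 0$ integers. 1. If $s\le 2m-1$, then $$g_{K_{2m+1}-K_{1,s}}(q)=q^{m^2+m-s-1}\,(q-1)(q^3-1)\cdots(q^{2m-3}-1)\,\bigl(q^{2m}-q^s-q+1\bigr).$$ 2. If $s\le 2m-2$, then $$g_{K_{2m}-K_{1,s}}(q)=q^{m(m-1)}\,(q-1)(q^3-1)\cdots(q^{2m-3}-1)\,\bigl(q^{2m-1-s}-1\bigr).$$ Here $(q-1)(q^3-1)\cdots(q^{2m-3}-1)=\prod_{i=0}^{m-2}(q^{2i+1}-1)$ is the empty product $1$ when $m=1$.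 -/

import Mathlib

open scoped Classical in
/-- The set of spanning trees of `G`, each one given by its set of edges. -/
noncomputable def spanningTrees {V : Type*} [Fintype V] (G : SimpleGraph V) :
    Finset (Finset G.edgeSet) :=
  {T | (SimpleGraph.fromEdgeSet {e : Sym2 V | ∃ he : e ∈ G.edgeSet, ⟨e, he⟩ ∈ T}).IsTree}

/-- The spanning tree polynomial `Q_G(x) = ∑_T ∏_{e ∈ T} x_e`, in one variable per edge of `G`,
where `T` ranges over all spanning trees of `G`. -/
noncomputable def spanningTreePoly {V : Type*} [Fintype V] (G : SimpleGraph V) :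
    MvPolynomial G.edgeSet ℤ :=
  ∑ T ∈ spanningTrees G, ∏ e ∈ T, MvPolynomial.X e

/-- `g_G(q)` for `q = #F`: the number of ways of substituting elements of the finite field `F`
for the variables `x_e` so that `Q_G(x) ≠ 0`. -/
noncomputable def kontsevichCount {V : Type*} [Fintype V] (G : SimpleGraph V)
    (F : Type*) [Field F] [Fintype F] : ℕ :=
  Nat.card {x : G.edgeSet → F // MvPolynomial.aeval x (spanningTreePoly G) ≠ 0}

/-- The complete graph on `V` with the edges from `c` to the vertices in `S` removed.
If `c ∉ S`, this is the complete graph minus a star `K_{1,s}` with centre `c`, where `s = #S`. -/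
def completeMinusStar {V : Type*} (c : V) (S : Finset V) : SimpleGraph V :=
  (⊤ : SimpleGraph V).deleteEdges {e | ∃ v ∈ S, e = s(c, v)}

/-! By the matrix tree theorem, `Q_G` is the determinant of the Laplacian reduced at the centre `c`
of the star. Off the diagonal its entries are minus the weights of the edges avoiding `c`; its row
sums are the weights of the edges at `c`. So the weights correspond bijectively to the symmetric
matrices `M` of order `n - 1` whose row sums vanish on the leaves of the star, and `g_G(q)` counts
the invertible ones.

Sort these by `l = M *ᵥ 1`. For fixed `u ≠ 0`, the number of invertible symmetric `M` with `M *ᵥ u =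
l` is unchanged under the congruences `Pᵀ * M * P`. Hence it depends only on whether `l ⬝ᵥ u ≠ 0`,
or `l ⬝ᵥ u = 0` with `l ≠ 0`, or `l = 0`. A good basis reduces the first two cases to invertible
symmetric matrices of order one or two less; the third is impossible. Summing over `l` gives
`card_symmInv_rowSum_eq_zero`; without leaves it is a recursion that determines `symmInvCount`. -/

open scoped Classical in
/-- One step towards `c` along the parent function `f`, with `c` fixed. -/
noncomputable def parentStep {V : Type*} (c : V) (f : {v // v ≠ c} → V) (v : V) : V :=
  if h : v = c then c else f ⟨v, h⟩

/-- The parent function `f` leads every vertex to `c`. -/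
def IsRootedAt {V : Type*} (c : V) (f : {v // v ≠ c} → V) : Prop :=
  ∀ v, ∃ n, (parentStep c f)^[n] v = c

/-! ### Spanning trees as parent functions -/

section Parent

variable {V : Type*} {c : V} {f g : {v // v ≠ c} → V}

@[simp]
lemma parentStep_self : parentStep c f c = c := by simp [parentStep]

@[simp]
lemma parentStep_coe (v : {v // v ≠ c}) : parentStep c f v = f v := by simp [parentStep, v.2]

lemma exists_iterate_parentStep_iff (v : V) :
    (∃ n, (parentStep c f)^[n] v = c) ↔ ∃ n, (parentStep c f)^[n] (parentStep c f v) = c := by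
  constructor
  · rintro ⟨n, hn⟩
    refine ⟨n, ?_⟩
    rw [← Function.iterate_succ_apply, Function.iterate_succ_apply', hn, parentStep_self]
  · rintro ⟨n, hn⟩
    exact ⟨n + 1, by rwa [Function.iterate_succ_apply]⟩

/-- The number of steps to `c` serves. It supplies the inductions on trees and the triangular order
in the determinant. -/
lemma IsRootedAt.exists_depth (hf : IsRootedAt c f) :
    ∃ d : V → ℕ, ∀ v : {v // v ≠ c}, d (f v) < d v := by
  classical
  refine ⟨fun v => Nat.find (hf v), fun v => ?_⟩
  have hv := Nat.find_spec (hf v)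
  rcases hn : Nat.find (hf v) with _ | k
  · rw [hn] at hv
    exact absurd hv v.2
  · rw [hn, Function.iterate_succ_apply, parentStep_coe] at hv
    exact (Nat.lt_succ_of_le (Nat.find_min' (hf _) hv)).trans_eq hn.symm

lemma isRootedAt_of_depth (d : V → ℕ) (hd : ∀ v : {v // v ≠ c}, d (f v) < d v) :
    IsRootedAt c f := by
  intro v
  induction hn : d v using Nat.strong_induction_on generalizing v with
  | _ n ih =>
    by_cases hv : v = c
    · exact ⟨0, hv⟩
    · rw [exists_iterate_parentStep_iff]
      have h := hd ⟨v, hv⟩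
      rw [← parentStep_coe (f := f)] at h
      exact ih _ (hn ▸ h) _ rfl

lemma IsRootedAt.injective_edge (hf : IsRootedAt c f) :
    Function.Injective fun v : {v // v ≠ c} => s((v : V), f v) := by
  obtain ⟨d, hd⟩ := hf.exists_depth
  intro v w h
  rcases Sym2.eq_iff.1 h with ⟨h, -⟩ | ⟨h₁, h₂⟩
  · exact Subtype.ext h
  · have hv := hd v
    have hw := hd w
    rw [h₂] at hv
    rw [← h₁] at hw
    exact absurd hv hw.not_gt

lemma IsRootedAt.ne (hf : IsRootedAt c f) (v : {v // v ≠ c}) : (v : V) ≠ f v := by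
  obtain ⟨d, hd⟩ := hf.exists_depth
  intro h
  have := hd v
  rw [← h] at this
  exact this.false

lemma IsRootedAt.isTree [Finite V] (hf : IsRootedAt c f) :
    (SimpleGraph.fromEdgeSet (Set.range fun v : {v // v ≠ c} => s((v : V), f v))).IsTree := by
  classical
  have := Fintype.ofFinite V
  rw [SimpleGraph.isTree_iff_connected_and_card]
  constructor
  · rw [SimpleGraph.connected_iff_exists_forall_reachable]
    refine ⟨c, fun v => ?_⟩
    obtain ⟨n, hn⟩ := hf v
    induction n generalizing v with
    | zero => rw [show v = c from hn]
    | succ n ih =>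
      by_cases hv : v = c
      · rw [hv]
      · refine (ih _ hn).trans (SimpleGraph.Adj.reachable ?_)
        rw [SimpleGraph.adj_comm, SimpleGraph.fromEdgeSet_adj]
        have := parentStep_coe (f := f) ⟨v, hv⟩
        simp only at this
        rw [this]
        exact ⟨⟨⟨v, hv⟩, rfl⟩, hf.ne ⟨v, hv⟩⟩
  · have : (SimpleGraph.fromEdgeSet
        (Set.range fun v : {v // v ≠ c} => s((v : V), f v))).edgeSet =
        Set.range fun v : {v // v ≠ c} => s((v : V), f v) := by
      rw [SimpleGraph.edgeSet_fromEdgeSet, sdiff_eq_left, Set.disjoint_left]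
      rintro _ ⟨v, rfl⟩ h
      exact hf.ne v (by simpa using h)
    rw [this, Nat.card_range_of_injective hf.injective_edge, Nat.card_eq_fintype_card,
      Nat.card_eq_fintype_card, Fintype.card_subtype_compl, Fintype.card_subtype_eq]
    exact Nat.sub_add_cancel (Fintype.card_pos_iff.2 ⟨c⟩)

lemma SimpleGraph.Connected.exists_isRootedAt {H : SimpleGraph V} (hH : H.Connected) (c : V) :
    ∃ f : {v // v ≠ c} → V, IsRootedAt c f ∧ ∀ v : {v // v ≠ c}, H.Adj v (f v) := by
  have key (v : {v // v ≠ c}) : ∃ w, H.Adj v w ∧ H.dist w c < H.dist v c := by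
    obtain ⟨v, hv⟩ := v
    obtain ⟨p, hp⟩ := (hH v c).exists_walk_length_eq_dist
    simp only
    cases p with
    | nil => exact absurd rfl hv
    | cons h p =>
      refine ⟨_, h, ?_⟩
      rw [← hp, SimpleGraph.Walk.length_cons]
      exact Nat.lt_succ_of_le (SimpleGraph.dist_le p)
  choose f hf hd using key
  exact ⟨f, isRootedAt_of_depth (fun v => H.dist v c) hd, hf⟩

lemma SimpleGraph.IsTree.eq_of_le {H K : SimpleGraph V} (hH : H.IsTree) (hK : K.IsTree)
    (h : H ≤ K) : H = K :=
  (SimpleGraph.isTree_iff_minimal_connected.1 hK).eq_of_le hH.connected h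

/-- Induction on the depth for `g`. If `f` produced the edge from `v` to `g v` at the other end `w =
g v`, then `g w = f w = v` by induction, and `v`, `w` would each be deeper than the other. -/
lemma IsRootedAt.eq_of_range_eq (hf : IsRootedAt c f) (hg : IsRootedAt c g)
    (h : (Set.range fun v : {v // v ≠ c} => s((v : V), f v)) =
      Set.range fun v : {v // v ≠ c} => s((v : V), g v)) : f = g := by
  by_contra hfg
  obtain ⟨v, hv⟩ := Function.ne_iff.1 hfg
  obtain ⟨df, hdf⟩ := hf.exists_depth
  obtain ⟨d, hd⟩ := hg.exists_depth
  suffices ∀ n, ∀ v : {v // v ≠ c}, d v = n → f v = g v from hv (this _ v rfl)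
  intro n
  induction n using Nat.strong_induction_on with
  | _ n ih =>
    intro v hn
    by_contra hv
    obtain ⟨w, hw⟩ : s((v : V), g v) ∈ Set.range fun v : {v // v ≠ c} => s((v : V), f v) :=
      h ▸ ⟨v, rfl⟩
    rcases Sym2.eq_iff.1 hw with ⟨hwv, h2⟩ | ⟨hwv, h2⟩
    · obtain rfl := Subtype.ext hwv
      exact hv h2
    · have h3 := ih (d w) (by rw [hwv, ← hn]; exact hd v) w rfl
      have h4 := hd w
      have h5 := hd v
      rw [← h3, h2, hwv] at h4
      exact h4.not_gt h5

end Parent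

/-! ### The matrix tree theorem -/

section MatrixTree

variable {V : Type*} [Fintype V] [DecidableEq V] {R : Type*} [CommRing R]

/-- The Laplacian matrix of the weights `y`, with the row and the column of `c` deleted. -/
def reducedLaplacian (c : V) (y : Sym2 V → R) : Matrix {v // v ≠ c} {v // v ≠ c} R :=
  .of fun v w => ∑ u, y s((v : V), u) * ((if v = w then 1 else 0) - if u = w then 1 else 0)

/-- Parents have smaller depth, so grouping vertices by depth makes the matrix block triangular with
identity diagonal blocks. -/
lemma IsRootedAt.det_eq_one {c : V} {f : {v // v ≠ c} → V} (hf : IsRootedAt c f) :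
    (Matrix.of fun v w : {v // v ≠ c} =>
      ((if v = w then 1 else 0) - if f v = w then 1 else 0 : R)).det = 1 := by
  obtain ⟨d, hd⟩ := hf.exists_depth
  have hM : (Matrix.of fun v w : {v // v ≠ c} =>
      ((if v = w then 1 else 0) - if f v = w then 1 else 0 : R)).BlockTriangular
      fun v => OrderDual.toDual (d v) := by
    intro v w hvw
    have hvw : d v < d w := hvw
    have h1 : v ≠ w := by rintro rfl; exact hvw.false
    have h2 : f v ≠ w := by
      intro h
      have := hd v
      rw [h] at this
      exact this.not_gt hvw
    simp [h1, h2]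
  rw [hM.det]
  refine Finset.prod_eq_one fun k _ => ?_
  suffices h : Matrix.toSquareBlock _ _ k = 1 by rw [h, Matrix.det_one]
  ext ⟨v, hv⟩ ⟨w, hw⟩
  have h2 : f v ≠ w := by
    intro h
    have := hd v
    rw [h, OrderDual.toDual.injective (hv.trans hw.symm)] at this
    exact this.false
  simp [Matrix.toSquareBlock_def, h2, Matrix.one_apply]

/-- The indicator of the vertices that never reach `c` lies in the kernel. The kernel criterion
needs a domain, so the argument runs over `ℤ` and is then mapped to `R`. -/
lemma det_eq_zero_of_not_isRootedAt {c : V} {f : {v // v ≠ c} → V} (hf : ¬ IsRootedAt c f) :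
    (Matrix.of fun v w : {v // v ≠ c} =>
      ((if v = w then 1 else 0) - if f v = w then 1 else 0 : R)).det = 0 := by
  classical
  have hdet : (Matrix.of fun v w : {v // v ≠ c} =>
      ((if v = w then 1 else 0) - if f v = w then 1 else 0 : ℤ)).det = 0 := by
    rw [← Matrix.exists_mulVec_eq_zero_iff]
    simp only [IsRootedAt, not_forall] at hf
    obtain ⟨x, hx⟩ := hf
    have hc : ∃ n, (parentStep c f)^[n] c = c := ⟨0, rfl⟩
    refine ⟨fun v => if ∃ n, (parentStep c f)^[n] v = c then 0 else 1, ?_, ?_⟩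
    · intro h
      have hxc : x ≠ c := by rintro rfl; exact hx hc
      have := congrFun h ⟨x, hxc⟩
      simp [hx] at this
    · ext v
      simp only [Matrix.mulVec, dotProduct, Matrix.of_apply, sub_mul, Finset.sum_sub_distrib,
        ite_mul, one_mul, zero_mul, Finset.sum_ite_eq, Finset.mem_univ, if_true, Pi.zero_apply]
      rw [sub_eq_zero]
      have h1 := exists_iterate_parentStep_iff (f := f) (v : V)
      rw [parentStep_coe] at h1
      rw [if_congr h1 rfl rfl]
      by_cases hfv : f v = c
      · rw [hfv, if_pos hc, Finset.sum_eq_zero]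
        intro w _
        rw [if_neg w.2.symm]
      · rw [Finset.sum_eq_single ⟨f v, hfv⟩]
        · simp
        · intro w _ hw
          rw [if_neg fun h => hw (Subtype.ext h.symm)]
        · simp
  have := congrArg (Int.castRingHom R) hdet
  rw [RingHom.map_det, map_zero] at this
  convert this using 2
  ext v w
  simp only [Matrix.of_apply, RingHom.mapMatrix_apply, Matrix.map_apply, map_sub]
  split_ifs <;> simp

open scoped Classical in
/-- The matrix tree theorem, with trees given by their parent functions. -/
theorem det_reducedLaplacian (c : V) (y : Sym2 V → R) :
    (reducedLaplacian c y).det =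
      ∑ f : {v // v ≠ c} → V with IsRootedAt c f, ∏ v : {v // v ≠ c}, y s((v : V), f v) := by
  -- Row `v` is the sum over `u` of `y s(v, u)` times `e_v - e_u`, with `e_c = 0`. Multilinearity
  -- makes the determinant a sum over the choices `f` of one `u` per row.
  have h := (Matrix.detRowAlternating (R := R) (n := {v // v ≠ c})).toMultilinearMap.map_sum
    fun (v : {v // v ≠ c}) (u : V) => y s((v : V), u) •
      fun w : {v // v ≠ c} => ((if v = w then 1 else 0) - if u = w then 1 else 0 : R)
  have h1 : (reducedLaplacian c y).det = Matrix.detRowAlternating (fun v : {v // v ≠ c} =>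
      ∑ u, y s((v : V), u) •
        fun w : {v // v ≠ c} => ((if v = w then 1 else 0) - if u = w then 1 else 0 : R)) := by
    congr 1
    ext v w
    simp [reducedLaplacian]
  rw [h1]
  refine h.trans ?_
  rw [Finset.sum_filter]
  refine Finset.sum_congr rfl fun f _ => ?_
  rw [MultilinearMap.map_smul_univ]
  split_ifs with hf
  · exact (congrArg _ hf.det_eq_one).trans (by simp)
  · exact (congrArg _ (det_eq_zero_of_not_isRootedAt hf)).trans (by simp)

-- Extending the weights by zero kills the parent functions that use a non-edge; the others
-- correspond to the spanning trees of `G`.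
open scoped Classical in
lemma aeval_spanningTreePoly {F : Type*} [Field F] (G : SimpleGraph V) (c : V)
    (x : G.edgeSet → F) :
    MvPolynomial.aeval x (spanningTreePoly G) = (reducedLaplacian c fun e =>
      if h : e ∈ G.edgeSet then x ⟨e, h⟩ else 0).det := by
  rw [det_reducedLaplacian, spanningTreePoly, map_sum]
  simp only [map_prod, MvPolynomial.aeval_X]
  rw [← Finset.sum_filter_of_ne (p := fun f : {v // v ≠ c} → V => ∀ v : {v // v ≠ c}, s((v : V), f v) ∈ G.edgeSet)]
  swap
  · intro f _ hf v
    by_contra hv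
    exact hf (Finset.prod_eq_zero (Finset.mem_univ v) (dif_neg hv))
  symm
  have hrange (f : {v // v ≠ c} → V)
      (hG : ∀ v : {v // v ≠ c}, s((v : V), f v) ∈ G.edgeSet) :
      {e | ∃ he : e ∈ G.edgeSet, (⟨e, he⟩ : G.edgeSet) ∈
        Finset.univ.image fun v : {v // v ≠ c} => (⟨s((v : V), f v), hG v⟩ : G.edgeSet)} =
      Set.range fun v : {v // v ≠ c} => s((v : V), f v) := by
    ext e
    simp only [Finset.mem_image, Finset.mem_univ, true_and, Subtype.mk.injEq, Set.mem_ofPred_eq,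
      Set.mem_range]
    constructor
    · rintro ⟨_, v, hv⟩
      exact ⟨v, hv⟩
    · rintro ⟨v, rfl⟩
      exact ⟨hG v, v, rfl⟩
  refine Finset.sum_bij (fun f hf => Finset.univ.image fun v : {v // v ≠ c} =>
    ⟨s((v : V), f v), (Finset.mem_filter.1 hf).2 v⟩) ?_ ?_ ?_ ?_
  · intro f hf
    simp only [Finset.mem_filter, Finset.mem_univ, true_and] at hf
    simp only [spanningTrees, Finset.mem_filter, Finset.mem_univ, true_and]
    rw [hrange f hf.2]
    exact hf.1.isTree
  · intro f hf g hg hfg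
    simp only [Finset.mem_filter, Finset.mem_univ, true_and] at hf hg
    refine hf.1.eq_of_range_eq hg.1 ?_
    rw [← hrange f hf.2, ← hrange g hg.2, hfg]
  · intro T hT
    simp only [spanningTrees, Finset.mem_filter, Finset.mem_univ, true_and] at hT
    obtain ⟨f, hf, hadj⟩ := hT.connected.exists_isRootedAt c
    have hG (v : {v // v ≠ c}) :
        ∃ he : s((v : V), f v) ∈ G.edgeSet, (⟨_, he⟩ : G.edgeSet) ∈ T :=
      ((SimpleGraph.fromEdgeSet_adj _).1 (hadj v)).1
    refine ⟨f, Finset.mem_filter.2 ⟨Finset.mem_filter.2 ⟨Finset.mem_univ f, hf⟩,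
      fun v => (hG v).1⟩, ?_⟩
    have heq := hf.isTree.eq_of_le hT (by
      rw [SimpleGraph.fromEdgeSet_le]
      rintro _ ⟨⟨v, rfl⟩, -⟩
      exact hadj v)
    have hE := congrArg SimpleGraph.edgeSet heq
    rw [← hrange f (fun v => (hG v).1), SimpleGraph.edgeSet_fromEdgeSet,
      SimpleGraph.edgeSet_fromEdgeSet] at hE
    ext ⟨e, he⟩
    have hd : ¬ e.IsDiag := G.not_isDiag_of_mem_edgeSet he
    have := Set.ext_iff.1 hE e
    simpa [he, hd] using this
  · intro f hf
    simp only [Finset.mem_filter, Finset.mem_univ, true_and] at hf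
    rw [Finset.prod_image]
    · exact Finset.prod_congr rfl fun v _ => dif_pos (hf.2 v)
    · intro v _ w _ h
      exact hf.1.injective_edge (congrArg Subtype.val h)

end MatrixTree

/-! ### Bases adapted to a vector and a linear form -/

section BasisExtension

variable {K E : Type*} [Field K] [AddCommGroup E] [Module K E]

lemma Module.Dual.exists_basis_cons {k : ℕ} (ψ : Module.Dual K E) {x : E} (hx : ψ x ≠ 0)
    (b : Module.Basis (Fin k) K (LinearMap.ker ψ)) :
    ∃ b' : Module.Basis (Fin (k + 1)) K E, ⇑b' = Fin.cons x (Subtype.val ∘ ⇑b) := by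
  refine ⟨.mkFinCons x b ?_ ?_, Module.Basis.coe_mkFinCons ..⟩
  · intro a y hy h
    have := congrArg ψ h
    rw [LinearMap.mem_ker] at hy
    simpa [hy, hx] using this
  · intro z
    refine ⟨-(ψ z / ψ x), ?_⟩
    simp [hx]

lemma Module.Dual.exists_basis_of_apply_ne_zero [FiniteDimensional K E] {k : ℕ}
    (hk : Module.finrank K E = k + 1) (ψ : Module.Dual K E) {x : E} (hx : ψ x ≠ 0) :
    ∃ b : Module.Basis (Fin (k + 1)) K E, b 0 = x ∧ ∀ i : Fin k, ψ (b i.succ) = 0 := by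
  have hψ : ψ ≠ 0 := by rintro rfl; exact hx rfl
  have h := Module.Dual.finrank_ker_add_one_of_ne_zero hψ
  obtain ⟨b, hb⟩ := ψ.exists_basis_cons hx
    (Module.finBasisOfFinrankEq K (LinearMap.ker ψ) (n := k) (by omega))
  exact ⟨b, by simp [hb], fun i => by simp [hb]⟩

lemma Module.Dual.exists_basis_of_apply_eq_zero [FiniteDimensional K E] {k : ℕ}
    (hk : Module.finrank K E = k + 2) {ψ : Module.Dual K E} (hψ : ψ ≠ 0) {x : E} (hx : x ≠ 0)
    (h0 : ψ x = 0) :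
    ∃ b : Module.Basis (Fin (k + 2)) K E,
      b 1 = x ∧ ψ (b 0) = 1 ∧ ∀ i : Fin (k + 1), ψ (b i.succ) = 0 := by
  have h := Module.Dual.finrank_ker_add_one_of_ne_zero hψ
  obtain ⟨y, hy⟩ := LinearMap.surjective hψ 1
  have hx' : (⟨x, h0⟩ : LinearMap.ker ψ) ≠ 0 := fun h => hx (congrArg Subtype.val h)
  -- The form `φ` serves only to complete `x` to a basis of the kernel of `ψ`.
  obtain ⟨φ, hφ⟩ := not_forall.1 (mt (Module.forall_dual_apply_eq_zero_iff K _).1 hx')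
  obtain ⟨b, hb, -⟩ := φ.exists_basis_of_apply_ne_zero (k := k) (by omega) hφ
  obtain ⟨b', hb'⟩ := ψ.exists_basis_cons (x := y) (by simp [hy]) b
  refine ⟨b', ?_, by simp [hb', hy], fun i => by simp [hb']⟩
  rw [hb', ← Fin.succ_zero_eq_one, Fin.cons_succ, Function.comp_apply, hb]

end BasisExtension

/-! ### Counting invertible symmetric matrices -/

section SymmetricCount

open Matrix

/-- The number of invertible symmetric matrices of order `N` over `F`. -/
noncomputable def symmInvCount (F : Type*) [Field F] (N : ℕ) : ℕ :=
  Nat.card {M : Matrix (Fin N) (Fin N) F // M.IsSymm ∧ M.det ≠ 0}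

/-- The number of invertible symmetric matrices that map `u` to `l`. -/
noncomputable def symmInvFiberCount {F : Type*} [Field F] {N : ℕ} (u l : Fin N → F) : ℕ :=
  Nat.card {M : Matrix (Fin N) (Fin N) F // (M.IsSymm ∧ M.det ≠ 0) ∧ M *ᵥ u = l}

variable {F : Type*} [Field F]

/-- The bijection is the congruence `M ↦ Pᵀ * M * P`. -/
lemma symmInvFiberCount_mulVec {N : ℕ} {P Q : Matrix (Fin N) (Fin N) F} (hPQ : P * Q = 1)
    (e l : Fin N → F) :
    symmInvFiberCount (P *ᵥ e) l = symmInvFiberCount e (Pᵀ *ᵥ l) := by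
  have hQP : Q * P = 1 := mul_eq_one_comm.1 hPQ
  have hPt : Pᵀ * Qᵀ = 1 := by rw [← transpose_mul, hQP, transpose_one]
  have hQt : Qᵀ * Pᵀ = 1 := by rw [← transpose_mul, hPQ, transpose_one]
  have hP : P.det ≠ 0 := fun h => by simpa [h] using congrArg det hPQ
  have hQ : Q.det ≠ 0 := fun h => by simpa [h] using congrArg det hPQ
  refine Nat.card_congr ⟨fun M => ⟨Pᵀ * M.1 * P, ⟨?_, ?_⟩, ?_⟩,
    fun M => ⟨Qᵀ * M.1 * Q, ⟨?_, ?_⟩, ?_⟩, fun M => Subtype.ext ?_, fun M => Subtype.ext ?_⟩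
  · have := M.2.1.1
    simp [Matrix.IsSymm, transpose_mul, Matrix.mul_assoc, this.eq]
  · simp [M.2.1.2, hP]
  · simp [← mulVec_mulVec, M.2.2]
  · have := M.2.1.1
    simp [Matrix.IsSymm, transpose_mul, Matrix.mul_assoc, this.eq]
  · simp [M.2.1.2, hQ]
  · rw [mulVec_mulVec, Matrix.mul_assoc, hQP, Matrix.mul_one, ← mulVec_mulVec, M.2.2,
      mulVec_mulVec, hQt, one_mulVec]
  · calc Qᵀ * (Pᵀ * M.1 * P) * Q = (Qᵀ * Pᵀ) * M.1 * (P * Q) := by simp only [Matrix.mul_assoc]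
      _ = M.1 := by rw [hQt, hPQ, Matrix.one_mul, Matrix.mul_one]
  · calc Pᵀ * (Qᵀ * M.1 * Q) * P = (Pᵀ * Qᵀ) * M.1 * (Q * P) := by simp only [Matrix.mul_assoc]
      _ = M.1 := by rw [hPt, hQP, Matrix.one_mul, Matrix.mul_one]

lemma symmInvFiberCount_basis {N : ℕ} (b : Module.Basis (Fin N) F (Fin N → F)) (i : Fin N)
    (l : Fin N → F) :
    symmInvFiberCount (b i) l = symmInvFiberCount (Pi.single i 1) fun j => l ⬝ᵥ b j := by
  have h := symmInvFiberCount_mulVec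
    ((Pi.basisFun F (Fin N)).toMatrix_mul_toMatrix_flip b) (Pi.single i 1) l
  convert h using 1
  · congr 1
    ext j
    simp [Module.Basis.toMatrix_apply]
  · congr 1
    ext j
    simp [mulVec, Module.Basis.toMatrix_apply, dotProduct, mul_comm]

/-- By symmetry `M` is block diagonal with blocks `a` and an arbitrary invertible symmetric `D`. -/
lemma symmInvFiberCount_single_zero {k : ℕ} {a : F} (ha : a ≠ 0) :
    symmInvFiberCount (Pi.single (0 : Fin (k + 1)) 1) (Pi.single 0 a) = symmInvCount F k := by
  have hdet (M : Matrix (Fin (k + 1)) (Fin (k + 1)) F) (h : M.col 0 = Pi.single 0 a) :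
      M.det = a * (M.submatrix Fin.succ Fin.succ).det := by
    rw [det_succ_column_zero, Fin.sum_univ_succ, Finset.sum_eq_zero]
    · have := congrFun h 0
      simp only [col_apply, Pi.single_eq_same] at this
      simp [this]
    · intro i _
      have := congrFun h i.succ
      simp only [col_apply, Pi.single_eq_of_ne (Fin.succ_ne_zero i)] at this
      simp [this]
  let f (D : Matrix (Fin k) (Fin k) F) : Matrix (Fin (k + 1)) (Fin (k + 1)) F :=
    .of (Fin.cons (Fin.cons a 0) fun i => Fin.cons 0 (D i))
  have hcol (D) : (f D).col 0 = Pi.single 0 a := by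
    ext i
    cases i using Fin.cases <;> simp [f]
  have hsub (D) : (f D).submatrix Fin.succ Fin.succ = D := by
    ext i j
    simp [f]
  refine Nat.card_congr ⟨fun M => ⟨M.1.submatrix Fin.succ Fin.succ, M.2.1.1.submatrix _, ?_⟩,
    fun D => ⟨f D, ⟨?_, ?_⟩, ?_⟩, fun M => Subtype.ext ?_, fun D => Subtype.ext (hsub _)⟩
  · have h := M.2.1.2
    rw [hdet _ (by simpa using M.2.2)] at h
    exact right_ne_zero_of_mul h
  · ext i j
    have := D.2.1.apply
    cases i using Fin.cases <;> cases j using Fin.cases <;> simp [f, this]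
  · rw [hdet _ (hcol _), hsub]
    exact mul_ne_zero ha D.2.2
  · simpa using hcol _
  · have h : M.1.col 0 = Pi.single 0 a := by simpa using M.2.2
    have h0 (i) : M.1 i 0 = (Pi.single 0 a : Fin (k + 1) → F) i := congrFun h i
    have h1 (i) : M.1 0 i = (Pi.single 0 a : Fin (k + 1) → F) i := by rw [← M.2.1.1.apply, h0]
    ext i j
    cases i using Fin.cases <;> cases j using Fin.cases <;> simp [f, h0, h1]

/-- Row and column `1` have a single nonzero entry, at index `0`, so the determinant is `-det D`
with `D` the block on the indices from `2` on. The `k + 1` entries `r`, `v` of row `0` stay free. -/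
lemma symmInvFiberCount_single_one [Fintype F] {k : ℕ} :
    symmInvFiberCount (Pi.single (1 : Fin (k + 2)) (1 : F)) (Pi.single 0 1) =
      Fintype.card F ^ (k + 1) * symmInvCount F k := by
  have hdet (M : Matrix (Fin (k + 2)) (Fin (k + 2)) F) (hM : M.IsSymm)
      (h : M.col 1 = Pi.single 0 1) :
      M.det = -(M.submatrix (Fin.succ ∘ Fin.succ) (Fin.succ ∘ Fin.succ)).det := by
    have h0 (i) : M i 1 = (Pi.single 0 1 : Fin (k + 2) → F) i := congrFun h i
    have h1 (i) : M 1 i = (Pi.single 0 1 : Fin (k + 2) → F) i := by rw [← hM.apply, h0]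
    rw [det_succ_row M 1, Fin.sum_univ_succ, Finset.sum_eq_zero, det_succ_column_zero,
      Fin.sum_univ_succ, Finset.sum_eq_zero]
    · have : (Fin.succAbove (1 : Fin (k + 2)) ∘ Fin.succ) = Fin.succ ∘ Fin.succ := by
        ext i
        simp [Fin.succAbove, Fin.lt_def]
      simp [h0, h1, this]
    · intro i _
      simp [h0]
    · intro i _
      simp [h1]
  let f (r : F) (v : Fin k → F) (D : Matrix (Fin k) (Fin k) F) :
      Matrix (Fin (k + 2)) (Fin (k + 2)) F :=
    .of (Fin.cons (Fin.cons r (Fin.cons 1 v)) (Fin.cons (Fin.cons 1 0)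
      fun i => Fin.cons (v i) (Fin.cons 0 (D i))))
  have hcol (r v D) : (f r v D).col 1 = Pi.single 0 1 := by
    ext i
    rw [← Fin.succ_zero_eq_one]
    cases i using Fin.cases with
    | zero => simp [f]
    | succ i => cases i using Fin.cases <;> simp [f]
  have hsub (r v D) :
      (f r v D).submatrix (Fin.succ ∘ Fin.succ) (Fin.succ ∘ Fin.succ) = D := by
    ext i j
    simp [f]
  have hsymm (r v) {D} (hD : D.IsSymm) : (f r v D).IsSymm := by
    ext i j
    have := hD.apply
    cases i using Fin.cases with
    | zero =>
      cases j using Fin.cases with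
      | zero => simp [f]
      | succ j => cases j using Fin.cases <;> simp [f]
    | succ i =>
      cases j using Fin.cases with
      | zero => cases i using Fin.cases <;> simp [f]
      | succ j => cases i using Fin.cases <;> cases j using Fin.cases <;> simp [f, this]
  have e : {M : Matrix (Fin (k + 2)) (Fin (k + 2)) F // (M.IsSymm ∧ M.det ≠ 0) ∧
      M *ᵥ Pi.single 1 1 = Pi.single 0 1} ≃
      (F × (Fin k → F)) × {D : Matrix (Fin k) (Fin k) F // D.IsSymm ∧ D.det ≠ 0} := by
    refine ⟨fun M => ⟨⟨M.1 0 0, fun i => M.1 0 i.succ.succ⟩,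
      M.1.submatrix (Fin.succ ∘ Fin.succ) (Fin.succ ∘ Fin.succ), M.2.1.1.submatrix _, ?_⟩,
      fun x => ⟨f x.1.1 x.1.2 x.2.1, ⟨hsymm _ _ x.2.2.1, ?_⟩, ?_⟩, fun M => Subtype.ext ?_,
      fun x => ?_⟩
    · have h := M.2.1.2
      rw [hdet _ M.2.1.1 (by simpa using M.2.2)] at h
      exact neg_ne_zero.1 h
    · rw [hdet _ (hsymm _ _ x.2.2.1) (hcol _ _ _), hsub]
      exact neg_ne_zero.2 x.2.2.2
    · simpa using hcol _ _ _
    · have h : M.1.col 1 = Pi.single 0 1 := by simpa using M.2.2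
      have h0 (i) : M.1 i 1 = (Pi.single 0 1 : Fin (k + 2) → F) i := congrFun h i
      have h1 (i) : M.1 1 i = (Pi.single 0 1 : Fin (k + 2) → F) i := by rw [← M.2.1.1.apply, h0]
      have h2 := M.2.1.1.apply
      ext i j
      cases i using Fin.cases with
      | zero =>
        cases j using Fin.cases with
        | zero => simp [f]
        | succ j => cases j using Fin.cases <;> simp [f, h0]
      | succ i =>
        cases j using Fin.cases with
        | zero => cases i using Fin.cases <;> simp [f, h1, h2]
        | succ j => cases i using Fin.cases <;> cases j using Fin.cases <;> simp [f, h0, h1]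
    · exact Prod.ext (Prod.ext (by simp [f]) (by ext i; simp [f])) (Subtype.ext (hsub _ _ _))
  rw [symmInvFiberCount, Nat.card_congr e, Nat.card_prod, symmInvCount]
  simp [pow_succ, mul_comm]

theorem symmInvFiberCount_of_dotProduct_ne_zero {k : ℕ} {u l : Fin (k + 1) → F}
    (h : l ⬝ᵥ u ≠ 0) : symmInvFiberCount u l = symmInvCount F k := by
  obtain ⟨b, rfl, hb⟩ := (dotProductEquiv F (Fin (k + 1)) l).exists_basis_of_apply_ne_zero
    (k := k) (by simp) (x := u) h
  rw [symmInvFiberCount_basis, ← symmInvFiberCount_single_zero h]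
  congr 1
  ext i
  cases i using Fin.cases with
  | zero => simp
  | succ i => simpa using hb i

theorem symmInvFiberCount_of_dotProduct_eq_zero [Fintype F] {k : ℕ} {u l : Fin (k + 2) → F}
    (hu : u ≠ 0) (hl : l ≠ 0) (h : l ⬝ᵥ u = 0) :
    symmInvFiberCount u l = Fintype.card F ^ (k + 1) * symmInvCount F k := by
  obtain ⟨b, rfl, hb0, hb⟩ := Module.Dual.exists_basis_of_apply_eq_zero (k := k) (by simp)
    (ψ := dotProductEquiv F (Fin (k + 2)) l) (by simpa using hl) hu h
  rw [symmInvFiberCount_basis, ← symmInvFiberCount_single_one]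
  congr 1
  ext i
  cases i using Fin.cases with
  | zero => simpa using hb0
  | succ i => simpa using hb i

theorem symmInvFiberCount_zero_right {N : ℕ} {u : Fin N → F} (hu : u ≠ 0) :
    symmInvFiberCount u 0 = 0 := by
  rw [symmInvFiberCount, Nat.card_eq_zero]
  left
  rw [isEmpty_subtype]
  exact fun M hM => hM.1.2 (exists_mulVec_eq_zero_iff.1 ⟨u, hu, hM.2⟩)

lemma card_pi_eq_zero_on [Fintype F] {N : ℕ} (T : Finset (Fin N)) :
    Nat.card {l : Fin N → F // ∀ i ∈ T, l i = 0} = Fintype.card F ^ (N - T.card) := by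
  classical
  have e : {l : Fin N → F // ∀ i ∈ T, l i = 0} ≃ ({i // i ∉ T} → F) :=
    ⟨fun l i => l.1 i, fun l => ⟨fun i => if h : i ∈ T then 0 else l ⟨i, h⟩,
      fun i hi => dif_pos hi⟩, fun l => Subtype.ext <| funext fun i => by
        by_cases h : i ∈ T <;> simp [h, l.2], fun l => funext fun i => by simp [i.2]⟩
  rw [Nat.card_congr e]
  simp

/-- The sum condition determines the coordinate at some `j ∉ T`, so that coordinate may be reset to
zero. -/
lemma card_pi_eq_zero_on_sum_eq_zero [Fintype F] {N : ℕ} (T : Finset (Fin N))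
    (hT : T.card < N) :
    Nat.card {l : Fin N → F // (∀ i ∈ T, l i = 0) ∧ ∑ i, l i = 0} =
      Fintype.card F ^ (N - T.card - 1) := by
  classical
  obtain ⟨j, -, hj⟩ := Finset.exists_mem_notMem_of_card_lt_card
    (show T.card < (Finset.univ : Finset (Fin N)).card by simpa using hT)
  have hsum (l : Fin N → F) (a : F) :
      ∑ i, Function.update l j a i = a + ∑ i ∈ Finset.univ \ {j}, l i :=
    Finset.sum_update_of_mem (Finset.mem_univ j) _ _
  have hsum' (l : Fin N → F) : ∑ i, l i = l j + ∑ i ∈ Finset.univ \ {j}, l i := by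
    conv_lhs => rw [← Function.update_eq_self j l]
    rw [hsum]
  have hup (l : Fin N → F) (h : ∀ i ∈ T, l i = 0) (a : F) (i) (hi : i ∈ T) :
      Function.update l j a i = 0 := by
    rw [Function.update_of_ne (by rintro rfl; exact hj hi), h i hi]
  have e : {l : Fin N → F // (∀ i ∈ T, l i = 0) ∧ ∑ i, l i = 0} ≃
      {l : Fin N → F // ∀ i ∈ insert j T, l i = 0} := by
    refine ⟨fun l => ⟨Function.update l.1 j 0, ?_⟩,
      fun l => ⟨Function.update l.1 j (-∑ i, l.1 i), ?_, ?_⟩,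
      fun l => Subtype.ext ?_, fun l => Subtype.ext ?_⟩
    · simp only [Finset.forall_mem_insert, Function.update_self, true_and]
      exact hup _ l.2.1 _
    · exact hup _ (fun i hi => l.2 i (Finset.mem_insert_of_mem hi)) _
    · rw [hsum, hsum', l.2 j (Finset.mem_insert_self _ _)]
      simp
    · have h1 := l.2.2
      rw [hsum'] at h1
      simp only [Function.update_idem, hsum, zero_add]
      rw [← eq_neg_of_add_eq_zero_left h1, Function.update_eq_self]
    · simp only [Function.update_idem]
      exact Function.update_eq_self_iff.2 (l.2 j (Finset.mem_insert_self _ _)).symm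
  rw [Nat.card_congr e, card_pi_eq_zero_on, Finset.card_insert_of_notMem hj, Nat.sub_sub]

/-- The number of invertible symmetric matrices whose rows indexed by `T` sum to zero. -/
theorem card_symmInv_rowSum_eq_zero [Fintype F] {k : ℕ} (T : Finset (Fin (k + 1)))
    (hT : T.card ≤ k) :
    (Nat.card {M : Matrix (Fin (k + 1)) (Fin (k + 1)) F //
        (M.IsSymm ∧ M.det ≠ 0) ∧ ∀ i ∈ T, (M *ᵥ 1) i = 0} : ℤ) =
      ((Fintype.card F : ℤ) ^ (k + 1 - T.card) - (Fintype.card F : ℤ) ^ (k - T.card)) *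
          symmInvCount F k +
        ((Fintype.card F : ℤ) ^ (k - T.card) - 1) *
          ((Fintype.card F : ℤ) ^ k * symmInvCount F (k - 1)) := by
  classical
  let X : Finset (Fin (k + 1) → F) := {l | ∀ i ∈ T, l i = 0}
  have hX : X.card = Fintype.card F ^ (k + 1 - T.card) := by
    rw [← card_pi_eq_zero_on T, Nat.card_eq_fintype_card, Fintype.card_subtype]
  have hX0 : {l ∈ X | ∑ i, l i = 0}.card = Fintype.card F ^ (k - T.card) := by
    have h := card_pi_eq_zero_on_sum_eq_zero (F := F) T (by omega)
    rw [show k + 1 - T.card - 1 = k - T.card by omega] at h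
    rw [← h, Nat.card_eq_fintype_card, Fintype.card_subtype, Finset.filter_filter]
  have hsplit := Finset.card_filter_add_card_filter_not (s := X) (p := fun l => ∑ i, l i = 0)
  have h1 : (1 : Fin (k + 1) → F) ≠ 0 := one_ne_zero
  have hfib : Nat.card {M : Matrix (Fin (k + 1)) (Fin (k + 1)) F //
      (M.IsSymm ∧ M.det ≠ 0) ∧ ∀ i ∈ T, (M *ᵥ 1) i = 0} =
      ∑ l ∈ X, symmInvFiberCount 1 l := by
    rw [Nat.card_eq_fintype_card, Fintype.card_subtype,
      Finset.card_eq_sum_card_fiberwise (f := fun M => M *ᵥ 1) (t := X)]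
    · refine Finset.sum_congr rfl fun l hl => ?_
      rw [symmInvFiberCount, Nat.card_eq_fintype_card, Fintype.card_subtype,
        Finset.filter_filter]
      congr 1
      ext M
      simp only [Finset.mem_filter, Finset.mem_univ, true_and]
      constructor
      · exact fun h => ⟨h.1.1, h.2⟩
      · exact fun h => ⟨⟨h.1, by rw [h.2]; exact (Finset.mem_filter.1 hl).2⟩, h.2⟩
    · intro M hM
      simpa [X] using (Finset.mem_filter.1 hM).2.2
  have hne : ∑ l ∈ X with ¬ ∑ i, l i = 0, symmInvFiberCount 1 l =
      {l ∈ X | ¬ ∑ i, l i = 0}.card * symmInvCount F k := by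
    refine Finset.sum_const_nat fun l hl => ?_
    refine symmInvFiberCount_of_dotProduct_ne_zero ?_
    simpa [dotProduct] using (Finset.mem_filter.1 hl).2
  -- The vector `l = 0` has sum zero but an empty fiber; this is the `- 1` in the count.
  have hmem : (0 : Fin (k + 1) → F) ∈ {l ∈ X | ∑ i, l i = 0} := by simp [X]
  have heq : ∑ l ∈ X with ∑ i, l i = 0, symmInvFiberCount 1 l =
      ({l ∈ X | ∑ i, l i = 0}.card - 1) *
        (Fintype.card F ^ k * symmInvCount F (k - 1)) := by
    rw [← Finset.add_sum_erase _ _ hmem, symmInvFiberCount_zero_right h1, zero_add,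
      ← Finset.card_erase_of_mem hmem]
    refine Finset.sum_const_nat fun l hl => ?_
    rw [Finset.mem_erase, Finset.mem_filter] at hl
    -- For `k = 0` no nonzero `l` has sum zero, so the truncated `k - 1` does no harm.
    cases k with
    | zero =>
      refine absurd (funext fun i => ?_) hl.1
      rw [Fin.fin_one_eq_zero i]
      simpa using hl.2.2
    | succ k =>
      refine symmInvFiberCount_of_dotProduct_eq_zero h1 hl.1 ?_
      simpa [dotProduct] using hl.2.2
  have hle : 1 ≤ Fintype.card F ^ (k - T.card) := Nat.one_le_pow _ _ Fintype.card_pos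
  rw [hfib, ← Finset.sum_filter_add_sum_filter_not X (fun l => ∑ i, l i = 0), heq, hne, hX0]
  rw [hX, hX0] at hsplit
  have hsplit' : (({l ∈ X | ¬ ∑ i, l i = 0}.card : ℕ) : ℤ) =
      (Fintype.card F : ℤ) ^ (k + 1 - T.card) - (Fintype.card F : ℤ) ^ (k - T.card) := by
    rw [eq_sub_iff_add_eq']
    exact_mod_cast hsplit
  push_cast [Nat.cast_sub hle]
  rw [hsplit']
  ring

theorem symmInvCount_zero : symmInvCount F 0 = 1 := by
  rw [symmInvCount, Nat.card_eq_one_iff_unique]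
  exact ⟨inferInstance, ⟨0, by ext i; exact i.elim0, by simp⟩⟩

theorem symmInvCount_succ [Fintype F] (k : ℕ) :
    (symmInvCount F (k + 1) : ℤ) =
      ((Fintype.card F : ℤ) ^ (k + 1) - (Fintype.card F : ℤ) ^ k) * symmInvCount F k +
        ((Fintype.card F : ℤ) ^ k - 1) *
          ((Fintype.card F : ℤ) ^ k * symmInvCount F (k - 1)) := by
  simpa [symmInvCount] using card_symmInv_rowSum_eq_zero (F := F) (∅ : Finset (Fin (k + 1)))
    (Nat.zero_le k)

/-- The recursion reaches back two orders, so both parities are carried through one induction. -/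
theorem symmInvCount_eq [Fintype F] (m : ℕ) :
    (symmInvCount F (2 * m) : ℤ) = (Fintype.card F : ℤ) ^ (m * (m + 1)) *
      ∏ i ∈ Finset.range m, ((Fintype.card F : ℤ) ^ (2 * i + 1) - 1) ∧
    (symmInvCount F (2 * m + 1) : ℤ) = (Fintype.card F : ℤ) ^ (m * (m + 1)) *
      ∏ i ∈ Finset.range (m + 1), ((Fintype.card F : ℤ) ^ (2 * i + 1) - 1) := by
  induction m with
  | zero =>
    have := symmInvCount_succ (F := F) 0
    simp_all [symmInvCount_zero]
  | succ m ih =>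
    have h1 : (symmInvCount F (2 * (m + 1)) : ℤ) = (Fintype.card F : ℤ) ^ ((m + 1) * (m + 1 + 1)) *
        ∏ i ∈ Finset.range (m + 1), ((Fintype.card F : ℤ) ^ (2 * i + 1) - 1) := by
      have h := symmInvCount_succ (F := F) (2 * m + 1)
      rw [Nat.add_sub_cancel, ih.1, ih.2, Finset.prod_range_succ] at h
      rw [show 2 * (m + 1) = 2 * m + 1 + 1 by ring, h, Finset.prod_range_succ]
      ring
    refine ⟨h1, ?_⟩
    have h := symmInvCount_succ (F := F) (2 * m + 2)
    rw [show 2 * m + 2 - 1 = 2 * m + 1 by omega, ih.2, show 2 * m + 2 = 2 * (m + 1) by ring,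
      h1] at h
    rw [h, Finset.prod_range_succ _ (m + 1)]
    ring

end SymmetricCount

/-! ### From edge weights to symmetric matrices -/

section CompleteMinusStar

open Matrix

lemma mem_edgeSet_completeMinusStar {V : Type*} {c : V} {S : Finset V} {v w : V} (hv : v ≠ c) (hw : w ≠ c)
    (h : v ≠ w) : s(v, w) ∈ (completeMinusStar c S).edgeSet := by
  simp [completeMinusStar, h, hv.symm, hw.symm, Ne.symm]

lemma mem_edgeSet_completeMinusStar_center {V : Type*} {c : V} {S : Finset V} {v : V} (hv : v ≠ c) :
    s(v, c) ∈ (completeMinusStar c S).edgeSet ↔ v ∉ S := by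
  simp [completeMinusStar, hv]

variable {V : Type*} [Fintype V] [DecidableEq V] {F : Type*} [Field F]

lemma reducedLaplacian_apply_of_ne (c : V) (y : Sym2 V → F) {v w : {v // v ≠ c}} (h : v ≠ w) :
    reducedLaplacian c y v w = -y s((v : V), w) := by
  simp [reducedLaplacian, h]

/-- The entries of `e_v - e_u` sum to zero unless `u = c`, whose column is deleted. -/
lemma reducedLaplacian_mulVec_one (c : V) (y : Sym2 V → F) (v : {v // v ≠ c}) :
    (reducedLaplacian c y *ᵥ 1) v = y s((v : V), c) := by
  have h (u : V) : ∑ w : {v // v ≠ c}, ((if v = w then 1 else 0) - if u = w then 1 else 0 : F) =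
      if u = c then 1 else 0 := by
    rw [Finset.sum_sub_distrib]
    by_cases hu : u = c
    · rw [if_pos hu, Finset.sum_eq_zero (f := fun w : {v // v ≠ c} => if u = w then (1 : F) else 0)]
      · simp
      · intro w _
        rw [if_neg]
        rw [hu]
        exact w.2.symm
    · rw [if_neg hu]
      have (w : {v // v ≠ c}) : (if u = w then (1 : F) else 0) = if ⟨u, hu⟩ = w then 1 else 0 :=
        if_congr (by rw [Subtype.ext_iff]) rfl rfl
      simp [this]
  simp only [mulVec, dotProduct, Pi.one_apply, mul_one, reducedLaplacian, of_apply]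
  rw [Finset.sum_comm]
  simp only [← Finset.mul_sum, h]
  simp

lemma reducedLaplacian_isSymm (c : V) (y : Sym2 V → F) : (reducedLaplacian c y).IsSymm := by
  ext v w
  by_cases h : v = w
  · rw [h, transpose_apply]
  · rw [transpose_apply, reducedLaplacian_apply_of_ne c y h,
      reducedLaplacian_apply_of_ne c y (Ne.symm h), Sym2.eq_swap]

lemma Matrix.ext_of_offDiag_of_mulVec_one {n : Type*} [Fintype n] [DecidableEq n]
    {M M' : Matrix n n F} (h : ∀ i j, i ≠ j → M i j = M' i j) (h1 : M *ᵥ 1 = M' *ᵥ 1) :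
    M = M' := by
  ext i j
  by_cases hij : i = j
  · subst hij
    have := congrFun h1 i
    simp only [mulVec, dotProduct, Pi.one_apply, mul_one] at this
    rw [← Finset.add_sum_erase _ _ (Finset.mem_univ i),
      ← Finset.add_sum_erase _ _ (Finset.mem_univ i),
      Finset.sum_congr rfl fun j hj => h i j (Finset.ne_of_mem_erase hj).symm] at this
    exact add_right_cancel this
  · exact h i j hij

open scoped Classical in
/-- The reduced Laplacian is a bijection from the edge weights of the complete graph minus a star
to the symmetric matrices whose rows indexed by the leaves of the star sum to zero. -/
theorem kontsevichCount_completeMinusStar [Fintype F] (c : V) (S : Finset V) :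
    kontsevichCount (completeMinusStar c S) F =
      Nat.card {M : Matrix {v // v ≠ c} {v // v ≠ c} F //
        (M.IsSymm ∧ M.det ≠ 0) ∧ ∀ v : {v // v ≠ c}, (v : V) ∈ S → (M *ᵥ 1) v = 0} := by
  let z (x : (completeMinusStar c S).edgeSet → F) (e : Sym2 V) : F :=
    if h : e ∈ (completeMinusStar c S).edgeSet then x ⟨e, h⟩ else 0
  have hz (x) : MvPolynomial.aeval x (spanningTreePoly (completeMinusStar c S)) =
      (reducedLaplacian c (z x)).det := aeval_spanningTreePoly ..
  refine Nat.card_congr (Equiv.ofBijective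
    (fun x => ⟨reducedLaplacian c (z x.1), ⟨reducedLaplacian_isSymm _ _, ?_⟩, ?_⟩) ⟨?_, ?_⟩)
  · rw [← hz]
    exact x.2
  · intro v hv
    rw [reducedLaplacian_mulVec_one]
    exact dif_neg fun h => (mem_edgeSet_completeMinusStar_center v.2).1 h hv
  · intro x x' h
    have h : reducedLaplacian c (z x.1) = reducedLaplacian c (z x'.1) := congrArg Subtype.val h
    have hc (v : V) (hv : v ≠ c) : z x.1 s(v, c) = z x'.1 s(v, c) := by
      have h1 := reducedLaplacian_mulVec_one c (z x.1) ⟨v, hv⟩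
      rw [h, reducedLaplacian_mulVec_one] at h1
      exact h1.symm
    suffices ∀ v w : V, v ≠ w → z x.1 s(v, w) = z x'.1 s(v, w) by
      refine Subtype.ext (funext ?_)
      rintro ⟨e, he⟩
      induction e using Sym2.inductionOn with
      | _ v w =>
        have h1 := this v w ((SimpleGraph.mem_edgeSet _).1 he).ne
        simpa only [z, dif_pos he] using h1
    intro v w hvw
    by_cases hv : v = c
    · rw [hv, Sym2.eq_swap]
      exact hc w (hv ▸ hvw.symm)
    by_cases hw : w = c
    · rw [hw]
      exact hc v hv
    · have hne : (⟨v, hv⟩ : {v // v ≠ c}) ≠ ⟨w, hw⟩ := fun h => hvw (congrArg Subtype.val h)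
      have h1 := reducedLaplacian_apply_of_ne c (z x.1) hne
      rw [h, reducedLaplacian_apply_of_ne c _ hne] at h1
      exact (neg_injective h1).symm
  · rintro ⟨M, ⟨hM, hdet⟩, hS⟩
    -- The inverse map: edges at `c` get row sums of `M`, other edges get negated entries. Values on
    -- loops are irrelevant.
    let y : Sym2 V → F := Sym2.lift ⟨fun u v =>
      if hu : u = c then if hv : v = c then 0 else (M *ᵥ 1) ⟨v, hv⟩
      else if hv : v = c then (M *ᵥ 1) ⟨u, hu⟩ else -M ⟨u, hu⟩ ⟨v, hv⟩, fun u v => by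
        dsimp only
        split_ifs
        · rfl
        · rfl
        · rfl
        · rw [hM.apply]⟩
    have hL : reducedLaplacian c (z fun e => y e.1) = M := by
      refine Matrix.ext_of_offDiag_of_mulVec_one ?_ ?_
      · intro v w hvw
        rw [reducedLaplacian_apply_of_ne _ _ hvw]
        have he : s((v : V), (w : V)) ∈ (completeMinusStar c S).edgeSet :=
          mem_edgeSet_completeMinusStar v.2 w.2 fun h => hvw (Subtype.ext h)
        simp [z, he, y, v.2, w.2]
      · ext v
        rw [reducedLaplacian_mulVec_one]
        have he := mem_edgeSet_completeMinusStar_center (S := S) v.2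
        by_cases hv : (v : V) ∈ S
        · rw [hS v hv]
          exact dif_neg fun h => he.1 h hv
        · simp only [z, dif_pos (he.2 hv)]
          simp [y, v.2]
    refine ⟨⟨fun e => y e.1, ?_⟩, Subtype.ext hL⟩
    rw [hz, hL]
    exact hdet

theorem kontsevichCount_completeMinusStar_eq [Fintype F] {c : V} {S : Finset V} (hc : c ∉ S)
    {k : ℕ} (hV : Fintype.card V = k + 2) (hS : S.card ≤ k) :
    (kontsevichCount (completeMinusStar c S) F : ℤ) =
      ((Fintype.card F : ℤ) ^ (k + 1 - S.card) - (Fintype.card F : ℤ) ^ (k - S.card)) *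
          symmInvCount F k +
        ((Fintype.card F : ℤ) ^ (k - S.card) - 1) *
          ((Fintype.card F : ℤ) ^ k * symmInvCount F (k - 1)) := by
  have e : {v // v ≠ c} ≃ Fin (k + 1) := Fintype.equivFinOfCardEq (by
    rw [Fintype.card_subtype_compl, Fintype.card_subtype_eq, hV]
    omega)
  let T : Finset (Fin (k + 1)) := {i | (e.symm i : V) ∈ S}
  have hT : T.card = S.card := by
    refine Finset.card_bij (fun i _ => (e.symm i : V)) ?_ ?_ ?_
    · intro i hi
      simpa [T] using hi
    · intro i _ j _ h
      exact e.symm.injective (Subtype.ext h)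
    · intro v hv
      exact ⟨e ⟨v, by rintro rfl; exact hc hv⟩, by simpa [T] using hv, by simp⟩
  rw [← hT, ← card_symmInv_rowSum_eq_zero T (hT ▸ hS), kontsevichCount_completeMinusStar]
  congr 1
  refine Nat.card_congr ((Matrix.reindex e e).subtypeEquiv fun M => ?_)
  have hsymm : M.IsSymm ↔ (Matrix.reindex e e M).IsSymm := by
    refine ⟨fun h => h.submatrix _, fun h => ?_⟩
    simpa using h.submatrix e
  have hrow (i) : (Matrix.reindex e e M *ᵥ 1) i = (M *ᵥ 1) (e.symm i) := by
    simp only [mulVec, dotProduct, reindex_apply, submatrix_apply, Pi.one_apply, mul_one]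
    exact e.symm.sum_comp fun w => M (e.symm i) w
  rw [det_reindex_self, hsymm]
  refine and_congr_right fun _ => ?_
  simp only [hrow, T, Finset.mem_filter, Finset.mem_univ, true_and]
  exact (e.symm.forall_congr_left (p := fun i => (e.symm i : V) ∈ S → (M *ᵥ 1) (e.symm i) = 0)
    |>.trans (by simp)).symm

end CompleteMinusStar

/-! ### The closed formulas -/

theorem mainTheorem5 (F : Type*) [Field F] [Fintype F] (q : ℕ) (hq : Fintype.card F = q)
    (V : Type*) [Fintype V] (c : V) (S : Finset V) (hc : c ∉ S)
    (m s : ℕ) (hm : 1 ≤ m) (hs : S.card = s) :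
    (Fintype.card V = 2 * m + 1 → s ≤ 2 * m - 1 →
      (kontsevichCount (completeMinusStar c S) F : ℤ) =
        (q : ℤ) ^ (m ^ 2 + m - s - 1) * (∏ i ∈ Finset.range (m - 1), ((q : ℤ) ^ (2 * i + 1) - 1)) *
          ((q : ℤ) ^ (2 * m) - (q : ℤ) ^ s - (q : ℤ) + 1)) ∧
    (Fintype.card V = 2 * m → s ≤ 2 * m - 2 →
      (kontsevichCount (completeMinusStar c S) F : ℤ) =
        (q : ℤ) ^ (m * (m - 1)) * (∏ i ∈ Finset.range (m - 1), ((q : ℤ) ^ (2 * i + 1) - 1)) *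
          ((q : ℤ) ^ (2 * m - 1 - s) - 1)) := by
  classical
  subst hq hs
  obtain ⟨m, rfl⟩ := Nat.exists_eq_add_of_le' hm
  simp only [Nat.add_sub_cancel]
  set q : ℤ := ((Fintype.card F : ℕ) : ℤ)
  constructor
  · intro hV hS
    -- Writing `2 * m + 1 = S.card + d` removes subtraction from the exponents, leaving a polynomial
    -- identity.
    obtain ⟨d, hd⟩ := Nat.exists_eq_add_of_le (show S.card ≤ 2 * m + 1 by omega)
    rw [kontsevichCount_completeMinusStar_eq hc (k := 2 * m + 1) (by omega) (by omega),
      Nat.add_sub_cancel, (symmInvCount_eq m).1, (symmInvCount_eq m).2, Finset.prod_range_succ,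
      show 2 * m + 1 + 1 - S.card = d + 1 by omega, show 2 * m + 1 - S.card = d by omega,
      show (m + 1) ^ 2 + (m + 1) - S.card - 1 = m * (m + 1) + d by
        have : (m + 1) ^ 2 = m * (m + 1) + m + 1 := by ring
        omega]
    have h : q ^ (2 * m + 1) = q ^ S.card * q ^ d := by rw [hd, pow_add]
    have h' : q ^ (2 * (m + 1)) = q ^ S.card * q ^ d * q := by rw [← h]; ring
    rw [h, h', pow_add q _ d, pow_succ q d]
    ring
  · intro hV hS
    rw [kontsevichCount_completeMinusStar_eq hc (k := 2 * m) (by omega) (by omega),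
      (symmInvCount_eq m).1, show 2 * (m + 1) - 1 - S.card = 2 * m - S.card + 1 by omega,
      show 2 * m + 1 - S.card = 2 * m - S.card + 1 by omega]
    -- For two vertices `2 * m - 1` truncates to `0`, but its term carries the factor `q ^ 0 - 1 =
    -- 0`.
    cases m with
    | zero =>
      have : S.card = 0 := by omega
      simp [this, q]
    | succ m =>
      rw [show 2 * (m + 1) - 1 = 2 * m + 1 by omega, (symmInvCount_eq m).2]
      generalize 2 * (m + 1) - S.card = d
      ring
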